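/- **Setting.** There are $m$ items and $n$ bidders. A valuation is a function $v:2^{[m]}\to[0,\infty)$ with $v(\emptyset)=0$ and $v(S)\le v(T)$ whenever $S\subseteq T$; it is submodular if $v(S\cup T)\le v(S)+v(T)-v(S\cap T)$ for all $S,T\subseteq[m]$. An allocation is a family $S=(S_i)_{i\in[n]}$ of pairwise disjoint subsets of $[m]$ (items may stay unallocated), and its welfare under $v=(v_1,\dots,v_n)$ is $\sum_i v_i(S_i)$. For a set $D\subseteq\mathbb R$ let $\mathcal F_D$ be the class of submodular valuations with values in $D$ (so $D=[0,\infty)$ gives all submodular valuations, and a finite $D$ gives valuations of bounded precision). A (deterministic) mechanism on $\mathcal F_D$, in the communication model, is a finite decision tree: at each internal node one bidder $i$ is asked an arbitrary yes/no question about $v_i$ and transmits the one-bit answer, which determines the next node; each leaf is labelled with an allocation and a vector of nonnegative prices, which are the output. The communication on a profile $v\in\mathcal F_D^n$ is the number of bits transmitted. The mechanism is VCG-based (maximal-in-range) if there is a fixed set $\mathcal H$ of allocations such that for every profile $v\in\mathcal F_D^n$ the allocation that is output belongs to $\mathcal H$ and maximizes $\sum_i v_i(S_i)$ over all $S\in\mathcal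 H$. It has approximation ratio $\alpha$ if for every profile $v\in\mathcal F_D^n$ and every allocation $S$, $\sum_i v_i(S_i)\le\alpha\sum_i v_i(T_i)$, where $T$ is the allocation that is output on $v$. **Theorem.** For every $\varepsilon>0$ and every $C>1$ there is $m_0=m_0(\varepsilon,C)$ such that the following holds for all $m\ge m_0$, all $n\ge C\,m^{\frac13-\varepsilon}$ and every $D\subseteq\mathbb R$ with $\{0,1,\dots,m\}\subseteq D$. Every VCG-based mechanism for $m$ items and $n$ bidders with valuations in $\mathcal F_D$ that has approximation ratio $m^{\frac13-\varepsilon}$ uses exponential communication: there is a profile in $\mathcal F_D^n$ on which at least $2^{m^{\varepsilon}}$ bits are transmitted. -/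

import Mathlib

noncomputable section

namespace CombAuction

/-- A valuation over the bundles of `m` items: nonnegative, normalized and nondecreasing. -/
structure IsValuation {m : ℕ} (v : Finset (Fin m) → ℝ) : Prop where
  nonneg : ∀ S, 0 ≤ v S
  normalized : v ∅ = 0
  nondecreasing : ∀ S T, S ⊆ T → v S ≤ v T

/-- Submodularity of a set function. -/
def IsSubmodular {m : ℕ} (v : Finset (Fin m) → ℝ) : Prop :=
  ∀ S T, v (S ∪ T) ≤ v S + v T - v (S ∩ T)

/-- The class of submodular valuations over `m` items all of whose values lie in `D`.
For `D = Set.Ici 0` (or `Set.univ`) these are all the submodular valuations; a finite `D`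
models valuations of bounded precision. -/
def submodularValuations (m : ℕ) (D : Set ℝ) : Set (Finset (Fin m) → ℝ) :=
  {v | IsValuation v ∧ IsSubmodular v ∧ ∀ S, v S ∈ D}

/-- An allocation of `m` items to `n` bidders: pairwise disjoint bundles
(some items may remain unallocated). -/
structure Allocation (n m : ℕ) where
  bundle : Fin n → Finset (Fin m)
  disjoint : ∀ i j, i ≠ j → Disjoint (bundle i) (bundle j)

/-- What a mechanism outputs: an allocation and a nonnegative price for every bidder. -/
structure Outcome (n m : ℕ) where
  alloc : Allocation n m
  price : Fin n → NNReal

/-- Social welfare of an allocation under a profile of valuations. -/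
def welfare {n m : ℕ} (v : Fin n → Finset (Fin m) → ℝ) (S : Allocation n m) : ℝ :=
  ∑ i, v i (S.bundle i)

/-- A deterministic mechanism in the communication model, for `n` bidders whose valuations
come from the class `V`: a decision tree. At an internal node one bidder `i` is asked an
arbitrary yes/no question about his own valuation, and transmits the one-bit answer; the next
step depends on all the bits transmitted so far. At a leaf an outcome is output. (A query with
a longer answer is a succession of such questions to the same bidder.) -/
inductive Mechanism (n m : ℕ) (V : Set (Finset (Fin m) → ℝ)) : Type
  | output (o : Outcome n m) : Mechanism n m V
  | query (i : Fin n) (q : V → Bool) (next : Bool → Mechanism n m V) : Mechanism n m V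

namespace Mechanism

variable {n m : ℕ} {V : Set (Finset (Fin m) → ℝ)}

/-- The outcome of the mechanism on a profile of valuations. -/
def run : Mechanism n m V → (Fin n → V) → Outcome n m
  | output o, _ => o
  | query i q next, v => (next (q (v i))).run v

/-- The number of bits transmitted when the mechanism is run on a profile of valuations. -/
def bits : Mechanism n m V → (Fin n → V) → ℕ
  | output _, _ => 0
  | query i q next, v => (next (q (v i))).bits v + 1

/-- The mechanism is VCG-based (maximal-in-range): there is a fixed bank `H` of allocations
such that on every profile the allocation that is output maximizes the social welfare over all
the allocations in `H`. -/
def IsVCGBased (M : Mechanism n m V) : Prop :=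
  ∃ H : Set (Allocation n m), ∀ v : Fin n → V,
    (M.run v).alloc ∈ H ∧
      ∀ S ∈ H, welfare (fun i => (v i).1) S ≤ welfare (fun i => (v i).1) (M.run v).alloc

/-- The mechanism has approximation ratio `α` w.r.t. `V`: on every profile of valuations from
`V`, the welfare of its allocation is at least `1 / α` times that of any other allocation. -/
def HasApproximationRatio (M : Mechanism n m V) (α : ℝ) : Prop :=
  ∀ (v : Fin n → V) (S : Allocation n m),
    welfare (fun i => (v i).1) S ≤ α * welfare (fun i => (v i).1) (M.run v).alloc

end Mechanism

end CombAuction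

end

/-! The range `H` of the mechanism is forced to be rich, and a rich range contains a hard two-bidder
problem. Richness: put `a = m ^ (1/3 - ε)` and `N = ⌈C * a⌉`. On additive valuations the ratio `a`
makes `H` agree with every assignment `g` of the items to `N` bidders on at least `m / a ≥ C * m /
N` items. A random `g` agrees with a fixed function on only `m / N` items on average, so a Chernoff
bound shows that exponentially many in `m / N` total functions are needed to do this
(`exp_le_card_of_agreement`). Conversely, suppose that no two bidders shatter more than `d` items. A
Sauer–Shelah argument with a potential, the product of the numbers of shattered sets over the pairs
of bidders, then extends all of `H` to at most `(m * N + 1) ^ O(d * N ^ 2 * log m)` total functions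
(`exists_extensions`). As `d * N ^ 3 * log² m` is small against `m` for `d = 2 * (⌈m ^ ε⌉ + 1)`,
some two bidders shatter `d` items. Hardness: being maximal in range, the mechanism solves the
two-bidder problem on these `d = 2 * k` items exactly. A fooling set indexed by the nonempty
families of `k`-subsets forces at least `2 ^ (k - 1)` bits (`exists_bits_gt_of_pairShatters`). -/

namespace CombAuction

open Finset

/-! ### Shattering by pairs of labels and extension of partial functions -/

section Shattering

open scoped Classical

variable {σ α ι : Type*}

/-- The set `X` is shattered by `H` with the labels `i` and `j`: every two-colouring of `X` by
`i` and `j` is realized by some member of `H`. Here `R h x i` means that `h` labels `x` by `i`. -/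
def PairShatters (R : σ → α → ι → Prop) (H : Set σ) (i j : ι) (X : Finset α) : Prop :=
  ∀ Y ⊆ X, ∃ h ∈ H, (∀ x ∈ Y, R h x i) ∧ ∀ x ∈ X, x ∉ Y → R h x j

theorem PairShatters.mono {R : σ → α → ι → Prop} {H H' : Set σ} {i j : ι} {X X' : Finset α}
    (h : PairShatters R H i j X) (hH : H ⊆ H') (hX : X' ⊆ X) : PairShatters R H' i j X' := by
  intro Y hY
  obtain ⟨s, hs, h1, h2⟩ := h Y (hY.trans hX)
  exact ⟨s, hH hs, h1, fun x hx => h2 x (hX hx)⟩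

/-- The members of `H` that label `x` by `i`. -/
def labelled (R : σ → α → ι → Prop) (H : Set σ) (x : α) (i : ι) : Set σ :=
  {h ∈ H | R h x i}

theorem labelled_subset (R : σ → α → ι → Prop) (H : Set σ) (x : α) (i : ι) :
    labelled R H x i ⊆ H := fun _ h => h.1

variable [Fintype α]

/-- The number of sets shattered with the labels `i` and `j`. -/
noncomputable def shatterCount (R : σ → α → ι → Prop) (H : Set σ) (i j : ι) : ℕ :=
  #{X : Finset α | PairShatters R H i j X}

theorem shatterCount_mono (R : σ → α → ι → Prop) {H H' : Set σ} (hH : H ⊆ H') (i j : ι) :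
    shatterCount R H i j ≤ shatterCount R H' i j := by
  refine card_le_card fun X hX => ?_
  simp only [mem_filter, mem_univ, true_and] at hX ⊢
  exact hX.mono hH le_rfl

theorem shatterCount_pos (R : σ → α → ι → Prop) {H : Set σ} (hH : H.Nonempty) (i j : ι) :
    0 < shatterCount R H i j := by
  obtain ⟨h, hh⟩ := hH
  refine card_pos.2 ⟨∅, ?_⟩
  simp only [mem_filter, mem_univ, true_and]
  intro Y hY
  rw [subset_empty] at hY
  subst hY
  exact ⟨h, hh, by simp⟩

/-- Each item has at most one label, so sets shattered by either subclass avoid `x`. A set shattered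
by both is counted twice on the left; on the right it is matched by itself and by its union with
`x`, where the label of `x` selects the subclass to use. -/
theorem shatterCount_add_le {R : σ → α → ι → Prop}
    (hR : ∀ h x i j, R h x i → R h x j → i = j) (H : Set σ) (x : α) {i j : ι} (hij : i ≠ j) :
    shatterCount R (labelled R H x i) i j + shatterCount R (labelled R H x j) i j ≤
      shatterCount R H i j := by
  unfold shatterCount
  set A : Finset (Finset α) := {X | PairShatters R (labelled R H x i) i j X} with hA
  set B : Finset (Finset α) := {X | PairShatters R (labelled R H x j) i j X} with hB
  have hxA : ∀ X ∈ A, x ∉ X := by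
    intro X hX hx
    rw [hA, mem_filter] at hX
    obtain ⟨h, hh, -, h2⟩ := hX.2 ∅ (empty_subset _)
    exact hij (hR h x i j hh.2 (h2 x hx (notMem_empty x)))
  have hxB : ∀ X ∈ B, x ∉ X := by
    intro X hX hx
    rw [hB, mem_filter] at hX
    obtain ⟨h, hh, h1, -⟩ := hX.2 X le_rfl
    exact hij (hR h x i j (h1 x hx) hh.2)
  have hdisj : Disjoint (A ∪ B) ((A ∩ B).image (insert x)) := by
    rw [Finset.disjoint_left]
    intro X hX hX'
    obtain ⟨Z, -, rfl⟩ := mem_image.1 hX'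
    rcases mem_union.1 hX with h | h
    · exact hxA _ h (mem_insert_self x Z)
    · exact hxB _ h (mem_insert_self x Z)
  have hcard : #((A ∩ B).image (insert x)) = #(A ∩ B) := by
    refine card_image_of_injOn fun X hX Y hY hXY => ?_
    have h1 := hxA X (mem_inter.1 hX).1
    have h2 := hxA Y (mem_inter.1 hY).1
    rw [← erase_insert h1, ← erase_insert h2]
    exact congrArg (fun Z => Z.erase x) hXY
  rw [← card_union_add_card_inter, ← hcard, ← card_union_of_disjoint hdisj]
  refine card_le_card fun X hX => ?_
  simp only [mem_filter, mem_univ, true_and]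
  rcases mem_union.1 hX with hX | hX
  · rcases mem_union.1 hX with hX | hX
    · exact ((mem_filter.1 hX).2).mono (labelled_subset R H x i) le_rfl
    · exact ((mem_filter.1 hX).2).mono (labelled_subset R H x j) le_rfl
  · obtain ⟨Z, hZ, rfl⟩ := mem_image.1 hX
    have hZA := (mem_filter.1 (mem_inter.1 hZ).1).2
    have hZB := (mem_filter.1 (mem_inter.1 hZ).2).2
    intro Y hY
    by_cases hx : x ∈ Y
    · obtain ⟨h, hh, h1, h2⟩ := hZA (Y.erase x) (by grind)
      refine ⟨h, hh.1, fun y hy => ?_, fun y hy hyY => h2 y (by grind) (by grind)⟩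
      rcases eq_or_ne y x with rfl | hyx
      · exact hh.2
      · exact h1 y (mem_erase.2 ⟨hyx, hy⟩)
    · obtain ⟨h, hh, h1, h2⟩ := hZB Y (by grind)
      refine ⟨h, hh.1, h1, fun y hy hyY => ?_⟩
      rcases eq_or_ne y x with rfl | hyx
      · exact hh.2
      · exact h2 y (by grind) hyY

/-- Encode a set by a list of `d` entries, padded with `none`. -/
theorem card_filter_card_le_le (d : ℕ) :
    #{X : Finset α | #X ≤ d} ≤ (Fintype.card α + 1) ^ d := by
  have hsub : ({X : Finset α | #X ≤ d} : Finset (Finset α)) ⊆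
      (univ : Finset (Fin d → Option α)).image
        (fun g => ({x | ∃ t, g t = some x} : Finset α)) := by
    intro X hX
    have hX : #X ≤ d := by simpa using hX
    refine mem_image.2 ⟨fun t => if h : (t : ℕ) < #X then some (X.equivFin.symm ⟨t, h⟩ : α)
      else none, mem_univ _, ?_⟩
    ext x
    simp only [mem_filter, mem_univ, true_and]
    constructor
    · rintro ⟨t, ht⟩
      split_ifs at ht with h
      · rw [← Option.some.inj ht]
        exact (X.equivFin.symm ⟨t, h⟩).2
    · intro hx
      refine ⟨⟨X.equivFin ⟨x, hx⟩, (X.equivFin ⟨x, hx⟩).2.trans_le hX⟩, ?_⟩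
      simp
  refine (card_le_card hsub).trans (card_image_le.trans ?_)
  simp

variable [Fintype ι]

/-- The product of the numbers of shattered sets over all the pairs of distinct labels. -/
noncomputable def shatterPotential (R : σ → α → ι → Prop) (H : Set σ) : ℕ :=
  ∏ p ∈ (univ : Finset ι).offDiag, shatterCount R H p.1 p.2

theorem shatterPotential_pos (R : σ → α → ι → Prop) {H : Set σ} (hH : H.Nonempty) :
    0 < shatterPotential R H :=
  prod_pos fun p _ => shatterCount_pos R hH p.1 p.2

theorem two_mul_shatterPotential_le (R : σ → α → ι → Prop) {H H' : Set σ} (hH : H' ⊆ H) {i j : ι}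
    (hij : i ≠ j) (h : 2 * shatterCount R H' i j ≤ shatterCount R H i j) :
    2 * shatterPotential R H' ≤ shatterPotential R H := by
  have hmem : (i, j) ∈ (univ : Finset ι).offDiag := by simpa using hij
  unfold shatterPotential
  rw [← mul_prod_erase _ _ hmem, ← mul_prod_erase _ _ hmem, ← mul_assoc]
  exact Nat.mul_le_mul h (prod_le_prod' fun p _ => shatterCount_mono R hH p.1 p.2)

/-- One of the two counts for the pair `(i, j)` is at most half of the count for `H`. If it is that
of `i`, its potential halves directly; otherwise the potential of `j` halves, and it dominates that
of `i`. -/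
theorem two_mul_shatterPotential_labelled_le {R : σ → α → ι → Prop}
    (hR : ∀ h x i j, R h x i → R h x j → i = j) (H : Set σ) (x : α) {i j : ι} (hij : i ≠ j)
    (hle : shatterPotential R (labelled R H x i) ≤ shatterPotential R (labelled R H x j)) :
    2 * shatterPotential R (labelled R H x i) ≤ shatterPotential R H := by
  have h := shatterCount_add_le hR H x hij
  rcases le_total (shatterCount R (labelled R H x i) i j)
    (shatterCount R (labelled R H x j) i j) with h' | h'
  · exact two_mul_shatterPotential_le R (labelled_subset R H x i) hij (by omega)
  · exact (Nat.mul_le_mul_left 2 hle).trans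
      (two_mul_shatterPotential_le R (labelled_subset R H x j) hij (by omega))

theorem shatterPotential_le (R : σ → α → ι → Prop) (H : Set σ) (d : ℕ)
    (hd : ∀ i j, i ≠ j → ∀ X, PairShatters R H i j X → #X ≤ d) :
    shatterPotential R H ≤ (Fintype.card α + 1) ^ (d * Fintype.card ι ^ 2) := by
  have h1 : ∀ p ∈ (univ : Finset ι).offDiag,
      shatterCount R H p.1 p.2 ≤ (Fintype.card α + 1) ^ d := by
    intro p hp
    refine (card_le_card fun X hX => ?_).trans (card_filter_card_le_le (α := α) d)
    simp only [mem_filter, mem_univ, true_and] at hX ⊢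
    exact hd _ _ (mem_offDiag.1 hp).2.2 X hX
  refine (prod_le_pow_card _ _ _ h1).trans ?_
  rw [← pow_mul]
  refine Nat.pow_le_pow_right (Nat.succ_pos _) (Nat.mul_le_mul_left d ?_)
  rw [offDiag_card, card_univ, sq]
  exact Nat.sub_le _ _

/-- A class of partial functions of small potential is extended by few total functions. -/
theorem exists_extensions [Nonempty ι] {R : σ → α → ι → Prop}
    (hR : ∀ h x i j, R h x i → R h x j → i = j) (k : ℕ) (H : Set σ)
    (hH : shatterPotential R H < 2 ^ k) :
    ∃ F : Finset (α → ι), #F ≤ (Fintype.card α * Fintype.card ι + 1) ^ k ∧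
      ∀ h ∈ H, ∃ f ∈ F, ∀ x i, R h x i → f x = i := by
  induction k generalizing H with
  | zero =>
    refine ⟨∅, by simp, fun h hh => ?_⟩
    have := shatterPotential_pos R ⟨h, hh⟩
    simp at hH
    omega
  | succ k ih =>
    have hmaj : ∀ x : α, ∃ j : ι, ∀ i, shatterPotential R (labelled R H x i) ≤
        shatterPotential R (labelled R H x j) := by
      intro x
      obtain ⟨j, -, hj⟩ := exists_max_image (univ : Finset ι)
        (fun i => shatterPotential R (labelled R H x i)) univ_nonempty
      exact ⟨j, fun i => hj i (mem_univ i)⟩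
    -- `f` picks at each point the label of largest potential. A member that contradicts `f` at `x`
    -- lies in a subclass of at most half the potential, to which the induction applies; there are
    -- at most `|α| * |ι|` such subclasses.
    choose f hf using hmaj
    have hrec : ∀ p : α × ι, ∃ F : Finset (α → ι),
        #F ≤ (Fintype.card α * Fintype.card ι + 1) ^ k ∧
        (p.2 ≠ f p.1 → ∀ h ∈ labelled R H p.1 p.2, ∃ g ∈ F, ∀ x i, R h x i → g x = i) := by
      intro p
      by_cases hp : p.2 = f p.1
      · exact ⟨∅, by simp, fun h => absurd hp h⟩
      · have := two_mul_shatterPotential_labelled_le hR H p.1 hp (hf p.1 p.2)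
        rw [pow_succ] at hH
        obtain ⟨F, hF, hF'⟩ := ih (labelled R H p.1 p.2) (by omega)
        exact ⟨F, hF, fun _ => hF'⟩
    choose F hF hF' using hrec
    refine ⟨insert f (univ.biUnion F), ?_, fun h hh => ?_⟩
    · have h1 : #(univ.biUnion F) ≤ (Fintype.card α * Fintype.card ι) *
          (Fintype.card α * Fintype.card ι + 1) ^ k := by
        refine (card_biUnion_le_card_mul _ _ _ fun p _ => hF p).trans ?_
        simp
      have h2 : 1 ≤ (Fintype.card α * Fintype.card ι + 1) ^ k := Nat.one_le_pow _ _ (by omega)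
      have h3 := card_insert_le f (univ.biUnion F)
      rw [pow_succ]
      nlinarith
    · by_cases hfh : ∀ x i, R h x i → f x = i
      · exact ⟨f, mem_insert_self _ _, hfh⟩
      · push Not at hfh
        obtain ⟨x, i, hxi, hne⟩ := hfh
        obtain ⟨g, hg, hg'⟩ := hF' (x, i) (Ne.symm hne) h ⟨hh, hxi⟩
        exact ⟨g, mem_insert_of_mem (mem_biUnion.2 ⟨(x, i), mem_univ _, hg⟩), hg'⟩

/-! ### A Chernoff bound for agreement -/

/-- A family of functions such that every function agrees with one of them on at least `t` points
is large. -/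
theorem card_pow_mul_rpow_le (F : Finset (α → ι)) {C t : ℝ} (hC : 1 ≤ C)
    (hF : ∀ g : α → ι, ∃ f ∈ F, t ≤ (#{x | f x = g x} : ℝ)) :
    (Fintype.card ι : ℝ) ^ Fintype.card α * C ^ t ≤
      #F * ((Fintype.card ι : ℝ) - 1 + C) ^ Fintype.card α := by
  -- The exponential moment of the agreement factorizes over the points: each contributes `C` for
  -- the agreeing label and `1` for every other one.
  have hsum : ∀ f : α → ι, ∑ g : α → ι, C ^ #{x | f x = g x} =
      ((Fintype.card ι : ℝ) - 1 + C) ^ Fintype.card α := by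
    intro f
    have h1 : ∀ g : α → ι, C ^ #{x | f x = g x} = ∏ x, if f x = g x then C else 1 := by
      intro g
      rw [prod_ite]
      simp
    have h2 : ∀ x, ∑ i, (if f x = i then C else 1) = (Fintype.card ι : ℝ) - 1 + C := by
      intro x
      have : ∀ i, (if f x = i then C else 1) = 1 + if f x = i then C - 1 else 0 := by
        intro i
        split_ifs <;> ring
      simp_rw [this]
      rw [sum_add_distrib]
      simp
      ring
    simp_rw [h1]
    rw [← Fintype.prod_sum fun x i => if f x = i then C else 1]
    simp_rw [h2]
    simp
  have hle : ∀ g : α → ι, C ^ t ≤ ∑ f ∈ F, C ^ #{x | f x = g x} := by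
    intro g
    obtain ⟨f, hf, hft⟩ := hF g
    refine le_trans ?_ (single_le_sum (f := fun f : α → ι => C ^ #{x | f x = g x})
      (fun _ _ => by positivity) hf)
    rw [← Real.rpow_natCast]
    exact Real.rpow_le_rpow_of_exponent_le hC hft
  calc (Fintype.card ι : ℝ) ^ Fintype.card α * C ^ t
      = ∑ _g : α → ι, C ^ t := by simp
    _ ≤ ∑ g : α → ι, ∑ f ∈ F, C ^ #{x | f x = g x} := sum_le_sum fun g _ => hle g
    _ = ∑ f ∈ F, ∑ g : α → ι, C ^ #{x | f x = g x} := sum_comm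
    _ = _ := by simp_rw [hsum]; simp

/-- With mean agreement `μ = |α| / |ι|`, take `t = C * μ` and bound `(1 + (C - 1) / |ι|) ^ |α|` by
`exp ((C - 1) * μ)`. -/
theorem exp_le_card_of_agreement [Nonempty ι] (F : Finset (α → ι)) {C : ℝ} (hC : 1 ≤ C)
    (hF : ∀ g : α → ι, ∃ f ∈ F,
      C * (Fintype.card α / Fintype.card ι) ≤ (#{x | f x = g x} : ℝ)) :
    Real.exp ((C * Real.log C - C + 1) * (Fintype.card α / Fintype.card ι)) ≤ #F := by
  have h := card_pow_mul_rpow_le F hC hF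
  have hn : (0 : ℝ) < Fintype.card ι := by exact_mod_cast Fintype.card_pos
  have h1 : ((Fintype.card ι : ℝ) - 1 + C) ^ Fintype.card α ≤
      (Fintype.card ι : ℝ) ^ Fintype.card α *
        Real.exp ((C - 1) * (Fintype.card α / Fintype.card ι)) := by
    have : (C - 1) * ((Fintype.card α : ℝ) / Fintype.card ι) =
        Fintype.card α * ((C - 1) / Fintype.card ι) := by ring
    rw [this, Real.exp_nat_mul, ← mul_pow]
    refine pow_le_pow_left₀ (by linarith) ?_ _
    have h2 := Real.add_one_le_exp ((C - 1) / (Fintype.card ι : ℝ))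
    have h3 : (Fintype.card ι : ℝ) - 1 + C =
        Fintype.card ι * ((C - 1) / (Fintype.card ι : ℝ) + 1) := by field_simp; ring
    rw [h3]
    exact mul_le_mul_of_nonneg_left h2 hn.le
  have h2 := h.trans (mul_le_mul_of_nonneg_left h1 (Nat.cast_nonneg #F))
  have hpow : (0 : ℝ) < (Fintype.card ι : ℝ) ^ Fintype.card α := by positivity
  have h3 : C ^ (C * ((Fintype.card α : ℝ) / Fintype.card ι)) ≤
      #F * Real.exp ((C - 1) * (Fintype.card α / Fintype.card ι)) := by
    refine le_of_mul_le_mul_left ?_ hpow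
    linarith
  rw [Real.rpow_def_of_pos (by linarith)] at h3
  have h4 := (div_le_iff₀ (Real.exp_pos _)).2 h3
  rw [← Real.exp_sub] at h4
  refine le_trans (le_of_eq ?_) h4
  congr 1
  ring

end Shattering

/-! ### Integer-valued submodular valuations -/

section Valuations

variable {m n : ℕ}

theorem natCast_mem_submodularValuations {D : Set ℝ} (hD : ∀ k : ℕ, k ≤ m → (k : ℝ) ∈ D)
    (v : Finset (Fin m) → ℕ) (h0 : v ∅ = 0) (hmono : ∀ S T, S ⊆ T → v S ≤ v T)
    (hsub : ∀ S T, v (S ∪ T) + v (S ∩ T) ≤ v S + v T) (hle : ∀ S, v S ≤ m) :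
    (fun S => (v S : ℝ)) ∈ submodularValuations m D := by
  refine ⟨⟨fun S => Nat.cast_nonneg _, by simp [h0], fun S T h => ?_⟩, fun S T => ?_,
    fun S => hD _ (hle S)⟩
  · exact_mod_cast hmono S T h
  · have : ((v (S ∪ T) + v (S ∩ T) : ℕ) : ℝ) ≤ ((v S + v T : ℕ) : ℝ) := by
      exact_mod_cast hsub S T
    push_cast at this
    linarith

theorem card_inter_mem_submodularValuations {D : Set ℝ} (hD : ∀ k : ℕ, k ≤ m → (k : ℝ) ∈ D)
    (A : Finset (Fin m)) :
    (fun S => ((#(S ∩ A) : ℕ) : ℝ)) ∈ submodularValuations m D := by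
  refine natCast_mem_submodularValuations hD (fun S => #(S ∩ A)) (by simp) ?_ ?_ ?_
  · exact fun S T h => card_le_card (inter_subset_inter_right h)
  · intro S T
    rw [union_inter_distrib_right, inter_inter_distrib_right, card_union_add_card_inter]
  · exact fun S => (card_le_univ _).trans (by simp)

theorem zero_mem_submodularValuations {D : Set ℝ} (hD : ∀ k : ℕ, k ≤ m → (k : ℝ) ∈ D) :
    (fun _ => (0 : ℝ)) ∈ submodularValuations m D := by
  simpa using natCast_mem_submodularValuations hD (fun _ => 0) rfl (by simp) (by simp) (by simp)

open scoped Classical in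
/-- The valuation `min (2 * |S ∩ X|) (2 * k)`, lowered by one on those bundles which meet `X` in a
set of size `k` without the property `p`. -/
noncomputable def halfSizeValuation (X : Finset (Fin m)) (k : ℕ) (p : Finset (Fin m) → Prop)
    (S : Finset (Fin m)) : ℕ :=
  if #(S ∩ X) < k then 2 * #(S ∩ X)
  else if #(S ∩ X) = k then (if p (S ∩ X) then 2 * k else 2 * k - 1)
  else 2 * k

theorem halfSizeValuation_mono (X : Finset (Fin m)) {k : ℕ} (p : Finset (Fin m) → Prop)
    {S T : Finset (Fin m)} (h : S ⊆ T) :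
    halfSizeValuation X k p S ≤ halfSizeValuation X k p T := by
  have hsub : S ∩ X ⊆ T ∩ X := inter_subset_inter_right h
  have hc := card_le_card hsub
  by_cases heq : #(S ∩ X) = #(T ∩ X)
  · have := eq_of_subset_of_card_le hsub heq.ge
    unfold halfSizeValuation
    rw [this]
  · unfold halfSizeValuation
    split_ifs <;> omega

/-- Comparable traces on `X` give equality. For incomparable ones the intersection is strictly
smaller than both; if both have size `k`, it is worth at most `2 * k - 2`, which pays for lowering
both by one. This is why the slope is two. -/
theorem halfSizeValuation_submodular (X : Finset (Fin m)) {k : ℕ} (p : Finset (Fin m) → Prop)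
    (S T : Finset (Fin m)) :
    halfSizeValuation X k p (S ∪ T) + halfSizeValuation X k p (S ∩ T) ≤
      halfSizeValuation X k p S + halfSizeValuation X k p T := by
  have hu : (S ∪ T) ∩ X = S ∩ X ∪ T ∩ X := union_inter_distrib_right S T X
  have hi : (S ∩ T) ∩ X = (S ∩ X) ∩ (T ∩ X) := inter_inter_distrib_right S T X
  unfold halfSizeValuation
  rw [hu, hi]
  by_cases hST : S ∩ X ⊆ T ∩ X
  · rw [union_eq_right.2 hST, inter_eq_left.2 hST, add_comm]
  by_cases hTS : T ∩ X ⊆ S ∩ X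
  · rw [union_eq_left.2 hTS, inter_eq_right.2 hTS]
  have h1 := card_union_add_card_inter (S ∩ X) (T ∩ X)
  have h2 : #((S ∩ X) ∩ (T ∩ X)) < #(S ∩ X) :=
    card_lt_card ⟨inter_subset_left, fun h => hST (h.trans inter_subset_right)⟩
  have h3 : #((S ∩ X) ∩ (T ∩ X)) < #(T ∩ X) :=
    card_lt_card ⟨inter_subset_right, fun h => hTS (h.trans inter_subset_left)⟩
  split_ifs <;> omega

theorem halfSizeValuation_le (X : Finset (Fin m)) (k : ℕ) (p : Finset (Fin m) → Prop)
    (S : Finset (Fin m)) : halfSizeValuation X k p S ≤ 2 * k := by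
  unfold halfSizeValuation
  split_ifs <;> omega

theorem halfSizeValuation_mem {D : Set ℝ} (hD : ∀ k : ℕ, k ≤ m → (k : ℝ) ∈ D)
    {X : Finset (Fin m)} {k : ℕ} (hX : #X = 2 * k) (p : Finset (Fin m) → Prop) (hk : 0 < k) :
    (fun S => (halfSizeValuation X k p S : ℝ)) ∈ submodularValuations m D := by
  refine natCast_mem_submodularValuations hD _ ?_ (fun S T h => halfSizeValuation_mono X p h)
    (halfSizeValuation_submodular X p) fun S => (halfSizeValuation_le X k p S).trans ?_
  · simp [halfSizeValuation, hk]
  · rw [← hX]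
    exact (card_le_univ X).trans (by simp)

end Valuations

/-! ### Fooling sets for decision trees -/

namespace Mechanism

variable {n m : ℕ} {V : Set (Finset (Fin m) → ℝ)}

/-- If more than `2 ^ B` profiles are each settled with `B` bits, then two of them, and all the
mixtures of these two, have the same outcome. -/
theorem exists_run_eq_of_bits_le {τ : Type*} (M : Mechanism n m V) (B : ℕ) (P : Finset τ)
    (prof : τ → Fin n → V) (hP : 2 ^ B < #P) (hB : ∀ a ∈ P, M.bits (prof a) ≤ B) :
    ∃ a ∈ P, ∃ b ∈ P, a ≠ b ∧ ∃ o, ∀ w : Fin n → V,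
      (∀ i, w i = prof a i ∨ w i = prof b i) → M.run w = o := by
  induction M generalizing B P with
  | output o =>
    obtain ⟨a, ha, b, hb, hab⟩ := one_lt_card.1 ((Nat.one_le_two_pow (n := B)).trans_lt hP)
    exact ⟨a, ha, b, hb, hab, o, fun w _ => rfl⟩
  | query i q next ih =>
    cases B with
    | zero =>
      obtain ⟨a, ha⟩ := card_pos.1 ((Nat.zero_le _).trans_lt hP)
      have := hB a ha
      simp [bits] at this
    | succ B =>
      have hcard := card_filter_add_card_filter_not (s := P) (fun a => q (prof a i) = true)
      -- The more frequent first answer keeps more than half of the required profiles.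
      have hex : ∃ c : Bool, 2 ^ B < #{a ∈ P | q (prof a i) = c} := by
        by_contra! hc
        have h1 := hc true
        have h2 := hc false
        simp only [Bool.not_eq_true] at hcard
        rw [pow_succ] at hP
        omega
      obtain ⟨c, hc⟩ := hex
      obtain ⟨a, ha, b, hb, hab, o, ho⟩ := ih c B _ hc (by
        intro a ha
        rw [mem_filter] at ha
        have := hB a ha.1
        simp only [bits, ha.2] at this
        omega)
      rw [mem_filter] at ha hb
      refine ⟨a, ha.1, b, hb.1, hab, o, fun w hw => ?_⟩
      -- Only bidder `i` is asked, and in a mixture this bidder has one of two valuations that give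
      -- the same answer.
      have hq : q (w i) = c := by
        rcases hw i with h | h
        · rw [h, ha.2]
        · rw [h, hb.2]
      simp only [run, hq]
      exact ho w hw

end Mechanism

/-! ### Hardness of a shattered pair, and existence of one -/

section Hardness

variable {n m : ℕ}

/-- The items and bidders matched by an allocation. -/
def Assigns (S : Allocation n m) (x : Fin m) (i : Fin n) : Prop := x ∈ S.bundle i

theorem Assigns.unique {S : Allocation n m} {x : Fin m} {i j : Fin n} (hi : Assigns S x i)
    (hj : Assigns S x j) : i = j := by
  by_contra h
  exact (Finset.disjoint_left.1 (S.disjoint i j h)) hi hj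

open scoped Classical in
/-- The profile in which bidder `i` has valuation `u`, bidder `j` has valuation `w`, and all other
bidders have valuation `z`. -/
def pairProfile {V : Type*} (i j : Fin n) (u w z : V) : Fin n → V :=
  fun t => if t = i then u else if t = j then w else z

theorem welfare_pairProfile {V : Set (Finset (Fin m) → ℝ)} {i j : Fin n} (hij : i ≠ j)
    (u w z : V) (hz : ∀ S, z.1 S = 0) (T : Allocation n m) :
    welfare (fun t => (pairProfile i j u w z t).1) T = u.1 (T.bundle i) + w.1 (T.bundle j) := by
  unfold welfare
  rw [Fintype.sum_eq_add i j hij]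
  · simp [pairProfile, hij.symm]
  · rintro t ⟨h1, h2⟩
    simp [pairProfile, h1, h2, hz]

/-- Two families of half-size sets that are not separated by the outcome satisfy an inclusion. -/
theorem subset_of_forall_le {X : Finset (Fin m)} {k : ℕ} (hk : 0 < k) (hX : #X = 2 * k)
    {F G : Finset (Finset (Fin m))} (hF : F ⊆ powersetCard k X) (hG : G ⊆ powersetCard k X)
    (hGne : G.Nonempty) {A B : Finset (Fin m)} (hAB : Disjoint A B)
    (h1 : ∀ Y ⊆ X, halfSizeValuation X k (· ∈ F) Y +
        halfSizeValuation X k (fun Z => X \ Z ∉ G) (X \ Y) ≤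
      halfSizeValuation X k (· ∈ F) A + halfSizeValuation X k (fun Z => X \ Z ∉ G) B)
    (h2 : ∀ Y ⊆ X, halfSizeValuation X k (· ∈ G) Y +
        halfSizeValuation X k (fun Z => X \ Z ∉ F) (X \ Y) ≤
      halfSizeValuation X k (· ∈ G) A + halfSizeValuation X k (fun Z => X \ Z ∉ F) B) :
    F ⊆ G := by
  intro Y hYF
  by_contra hYG
  have hval : ∀ (p : Finset (Fin m) → Prop) (Y : Finset (Fin m)), Y ⊆ X → #Y = k → p Y →
      halfSizeValuation X k p Y = 2 * k := by
    intro p Y hYX hYk hp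
    simp [halfSizeValuation, inter_eq_left.2 hYX, hYk, hp]
  have hval' : ∀ (p : Finset (Fin m) → Prop) (Y : Finset (Fin m)), Y ⊆ X → #Y = k →
      2 * k - 1 ≤ halfSizeValuation X k p Y := by
    intro p Y hYX hYk
    simp only [halfSizeValuation, inter_eq_left.2 hYX, hYk]
    split_ifs <;> omega
  have hcompl : ∀ Y ⊆ X, #Y = k → #(X \ Y) = k := by
    intro Y hYX hYk
    rw [card_sdiff_of_subset hYX]
    omega
  obtain ⟨hYX, hYk⟩ := mem_powersetCard.1 (hF hYF)
  -- Under the valuations of `F` and co-`G`, the split `(Y, X \ Y)` has the maximal value `4 * k`.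
  -- So `A` and `B` attain it too, which forces them to split `X` into halves with `A ∩ X` in `F`
  -- but not in `G`.
  have e1 := h1 Y hYX
  rw [hval (· ∈ F) Y hYX hYk hYF, hval _ (X \ Y) sdiff_subset (hcompl Y hYX hYk)
    (by rwa [Finset.sdiff_sdiff_eq_self hYX])] at e1
  have hdis : Disjoint (A ∩ X) (B ∩ X) := hAB.mono inter_subset_left inter_subset_left
  have hsub : A ∩ X ∪ B ∩ X ⊆ X := union_subset inter_subset_right inter_subset_right
  have hcard : #(A ∩ X) + #(B ∩ X) ≤ 2 * k := by
    rw [← card_union_of_disjoint hdis, ← hX]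
    exact card_le_card hsub
  have hA2 := halfSizeValuation_le X k (· ∈ F) A
  have hB2 := halfSizeValuation_le X k (fun Z => X \ Z ∉ G) B
  have hAeq : halfSizeValuation X k (· ∈ F) A = 2 * k := by omega
  have hBeq : halfSizeValuation X k (fun Z => X \ Z ∉ G) B = 2 * k := by omega
  have hAk : k ≤ #(A ∩ X) := by
    by_contra h
    simp only [halfSizeValuation, if_pos (not_le.1 h)] at hAeq
    omega
  have hBk : k ≤ #(B ∩ X) := by
    by_contra h
    simp only [halfSizeValuation, if_pos (not_le.1 h)] at hBeq
    omega
  have hA : #(A ∩ X) = k := by omega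
  have hB : #(B ∩ X) = k := by omega
  have hAF : A ∩ X ∈ F := by
    by_contra h
    simp only [halfSizeValuation, hA, h] at hAeq
    simp at hAeq
    omega
  have hBG : X \ (B ∩ X) ∉ G := by
    by_contra h
    simp only [halfSizeValuation, hB, h] at hBeq
    simp at hBeq
    omega
  have hBA : X \ (B ∩ X) = A ∩ X := by
    symm
    refine eq_of_subset_of_card_le ?_ ?_
    · exact subset_sdiff.2 ⟨inter_subset_right, hdis⟩
    · rw [hcompl _ inter_subset_right hB, hA]
  -- Under `G` and co-`F` this same split is lowered twice, to `4 * k - 2`, whereas any `Z ∈ G`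
  -- yields at least `4 * k - 1`.
  obtain ⟨Z, hZ⟩ := hGne
  obtain ⟨hZX, hZk⟩ := mem_powersetCard.1 (hG hZ)
  have e2 := h2 Z hZX
  rw [hval (· ∈ G) Z hZX hZk hZ] at e2
  have e3 := hval' (fun Z => X \ Z ∉ F) (X \ Z) sdiff_subset (hcompl Z hZX hZk)
  have e4 : halfSizeValuation X k (· ∈ G) A = 2 * k - 1 := by
    rw [hBA] at hBG
    simp [halfSizeValuation, hA, hBG]
  have e5 : halfSizeValuation X k (fun Z => X \ Z ∉ F) B = 2 * k - 1 := by
    simp only [halfSizeValuation, hB, hBA, hAF]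
    simp
  omega

/-- A maximal-in-range mechanism whose range shatters a set of `2 * k` items solves the exact
two-bidder problem on that set. -/
theorem exists_bits_gt_of_pairShatters {D : Set ℝ} (hD : ∀ k : ℕ, k ≤ m → (k : ℝ) ∈ D)
    (M : Mechanism n m (submodularValuations m D)) {H : Set (Allocation n m)}
    (hH : ∀ v : Fin n → submodularValuations m D, ∀ S ∈ H,
      welfare (fun i => (v i).1) S ≤ welfare (fun i => (v i).1) (M.run v).alloc)
    {i j : Fin n} (hij : i ≠ j) {X : Finset (Fin m)} {k : ℕ} (hk : 0 < k) (hX : #X = 2 * k)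
    (hsh : PairShatters Assigns H i j X) (B : ℕ) (hB : B < k.centralBinom) :
    ∃ v, B ≤ M.bits v := by
  by_contra! hlt
  set U : (Finset (Fin m) → Prop) → submodularValuations m D := fun p =>
    ⟨fun S => (halfSizeValuation X k p S : ℝ), halfSizeValuation_mem hD hX p hk⟩ with hU
  set z : submodularValuations m D := ⟨fun _ => 0, zero_mem_submodularValuations hD⟩ with hz
  -- The empty family is left out: `subset_of_forall_le` needs a member of the second family.
  set P : Finset (Finset (Finset (Fin m))) := (powersetCard k X).powerset.erase ∅ with hP
  have hPcard : #P = 2 ^ k.centralBinom - 1 := by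
    rw [hP, card_erase_of_mem (by simp), card_powerset, card_powersetCard, hX,
      Nat.centralBinom_eq_two_mul_choose]
  have hPgt : 2 ^ (B - 1) < #P := by
    have h1 : 2 ^ (k.centralBinom - 1) * 2 = 2 ^ k.centralBinom := by
      rw [← pow_succ]
      congr 1
      omega
    have h2 : 2 ≤ k.centralBinom := Nat.two_dvd_centralBinom_of_one_le hk |> Nat.le_of_dvd
      (Nat.centralBinom_pos k)
    have h3 : 2 ^ 1 ≤ 2 ^ (k.centralBinom - 1) := Nat.pow_le_pow_right (by norm_num) (by omega)
    have h4 : 2 ^ (B - 1) ≤ 2 ^ (k.centralBinom - 1) :=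
      Nat.pow_le_pow_right (by norm_num) (by omega)
    omega
  set prof : Finset (Finset (Fin m)) → Fin n → submodularValuations m D := fun F =>
    pairProfile i j (U (· ∈ F)) (U fun Z => X \ Z ∉ F) z with hprof
  obtain ⟨F, hF, G, hG, hFG, o, ho⟩ := M.exists_run_eq_of_bits_le (B - 1) P prof hPgt
    (fun a _ => by have := hlt (prof a); omega)
  -- Shattering puts into `H` an allocation giving at least `Y` to `i` and at least `X \ Y` to `j`;
  -- the output must do as well.
  have hkey : ∀ p q : Finset (Fin m) → Prop, M.run (pairProfile i j (U p) (U q) z) = o →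
      ∀ Y ⊆ X, halfSizeValuation X k p Y + halfSizeValuation X k q (X \ Y) ≤
        halfSizeValuation X k p (o.alloc.bundle i) +
          halfSizeValuation X k q (o.alloc.bundle j) := by
    intro p q hpq Y hY
    obtain ⟨S, hS, h1, h2⟩ := hsh Y hY
    have h := hH (pairProfile i j (U p) (U q) z) S hS
    rw [hpq, welfare_pairProfile hij _ _ _ (fun _ => rfl),
      welfare_pairProfile hij _ _ _ (fun _ => rfl)] at h
    have h' : halfSizeValuation X k p (S.bundle i) + halfSizeValuation X k q (S.bundle j) ≤
        halfSizeValuation X k p (o.alloc.bundle i) +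
          halfSizeValuation X k q (o.alloc.bundle j) := by
      simp only [hU] at h
      exact_mod_cast h
    exact (Nat.add_le_add (halfSizeValuation_mono X p h1)
      (halfSizeValuation_mono X q fun x hx => h2 x (mem_sdiff.1 hx).1
        (mem_sdiff.1 hx).2)).trans h'
  have hmix : ∀ F' G', (F' = F ∨ F' = G) → (G' = F ∨ G' = G) →
      M.run (pairProfile i j (U (· ∈ F')) (U fun Z => X \ Z ∉ G') z) = o := by
    intro F' G' h1 h2
    refine ho _ fun t => ?_
    rcases h1 with rfl | rfl <;> rcases h2 with rfl | rfl <;>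
      simp only [hprof, pairProfile] <;> split_ifs <;> simp
  rw [hP, mem_erase, mem_powerset] at hF hG
  have hd := o.alloc.disjoint i j hij
  refine hFG (subset_antisymm ?_ ?_)
  · exact subset_of_forall_le hk hX hF.2 hG.2 (nonempty_iff_ne_empty.2 hG.1) hd
      (hkey _ _ (hmix F G (by simp) (by simp))) (hkey _ _ (hmix G F (by simp) (by simp)))
  · exact subset_of_forall_le hk hX hG.2 hF.2 (nonempty_iff_ne_empty.2 hF.1) hd
      (hkey _ _ (hmix G F (by simp) (by simp))) (hkey _ _ (hmix F G (by simp) (by simp)))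

open scoped Classical in
/-- The range of a mechanism with approximation ratio `a` agrees well with every assignment of the
items to the bidders. -/
theorem exists_agreement_of_hasApproximationRatio {D : Set ℝ}
    (hD : ∀ k : ℕ, k ≤ m → (k : ℝ) ∈ D) (M : Mechanism n m (submodularValuations m D)) {a : ℝ}
    (hM : M.HasApproximationRatio a) (g : Fin m → Fin n) :
    ∃ v, (m : ℝ) ≤ a * #{x | Assigns (M.run v).alloc x (g x)} := by
  let A : Allocation n m := ⟨fun t => {x | g x = t}, fun s t hst => by
    rw [Finset.disjoint_left]
    intro x hx hx'
    exact hst ((mem_filter.1 hx).2.symm.trans (mem_filter.1 hx').2)⟩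
  -- Each bidder counts the received items that `g` assigns to that bidder. Welfare is then the
  -- agreement with `g`, and `A` itself has welfare `m`.
  let v : Fin n → submodularValuations m D := fun t =>
    ⟨_, card_inter_mem_submodularValuations hD (A.bundle t)⟩
  have hw : ∀ S : Allocation n m,
      welfare (fun t => (v t).1) S = #{x | Assigns S x (g x)} := by
    intro S
    have : #{x | Assigns S x (g x)} = ∑ t, #(S.bundle t ∩ A.bundle t) := by
      rw [card_eq_sum_card_fiberwise (f := g) (t := univ) (fun _ _ => by simp)]
      refine sum_congr rfl fun t _ => congrArg card ?_
      ext x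
      simp only [mem_filter, mem_univ, true_and, mem_inter, A]
      refine and_congr_left ?_
      rintro rfl
      exact Iff.rfl
    rw [this, welfare, Nat.cast_sum]
  refine ⟨v, ?_⟩
  have h := hM v A
  rw [hw, hw] at h
  simpa [Assigns, A] using h

/-- A range that agrees well with every assignment of the items to `N` of the bidders shatters a
large set of items. -/
theorem exists_pairShatters_of_agreement {N : ℕ} [NeZero N] (hN : N ≤ n) (H : Set (Allocation n m))
    {C : ℝ} (hC : 1 ≤ C) {d L : ℕ} (hd : 0 < d) (hL : m + 1 < 2 ^ L)
    (hH : ∀ g : Fin m → Fin N, ∃ S ∈ H, ∃ Y : Finset (Fin m), C * ((m : ℝ) / N) ≤ #Y ∧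
      ∀ x ∈ Y, Assigns S x (Fin.castLE hN (g x)))
    (hlarge : d * N ^ 2 * L * Real.log (m * N + 1) <
      (C * Real.log C - C + 1) * ((m : ℝ) / N)) :
    ∃ i j : Fin n, i ≠ j ∧ ∃ X : Finset (Fin m), #X = d ∧ PairShatters Assigns H i j X := by
  by_contra! hno
  let R : Allocation n m → Fin m → Fin N → Prop := fun S x i => Assigns S x (Fin.castLE hN i)
  have hR : ∀ h x i j, R h x i → R h x j → i = j := fun h x i j hi hj =>
    Fin.castLE_injective hN (Assigns.unique hi hj)
  have hsmall : ∀ i j, i ≠ j → ∀ X, PairShatters R H i j X → #X ≤ d := by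
    intro i j hij X hX
    by_contra! hcard
    obtain ⟨X', hX', hc⟩ := exists_subset_card_eq hcard.le
    exact hno _ _ (fun h => hij (Fin.castLE_injective hN h)) X' hc (hX.mono le_rfl hX')
  -- The potential is at most `(m + 1) ^ (d * N ^ 2)`, and `m + 1 < 2 ^ L`.
  have hpot : shatterPotential R H < 2 ^ (L * (d * N ^ 2)) := by
    refine (shatterPotential_le R H d hsmall).trans_lt ?_
    rw [pow_mul 2, Fintype.card_fin, Fintype.card_fin]
    exact Nat.pow_lt_pow_left hL (Nat.mul_ne_zero hd.ne' (pow_ne_zero _ (NeZero.ne N)))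
  obtain ⟨F, hF, hFH⟩ := exists_extensions hR _ H hpot
  have hexp := exp_le_card_of_agreement F hC (by
    intro g
    obtain ⟨S, hS, Y, hY, hYS⟩ := hH g
    obtain ⟨f, hf, hfS⟩ := hFH S hS
    refine ⟨f, hf, ?_⟩
    rw [Fintype.card_fin, Fintype.card_fin]
    refine hY.trans (Nat.cast_le.2 (card_le_card fun x hx => ?_))
    simp only [mem_filter, mem_univ, true_and]
    exact hfS x _ (hYS x hx))
  have hpos : (0 : ℝ) < m * N + 1 := by positivity
  have h1 := hexp.trans (Nat.cast_le.2 hF)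
  simp only [Fintype.card_fin] at h1
  push_cast at h1
  rw [← Real.log_le_log_iff (Real.exp_pos _) (by positivity), Real.log_exp, Real.log_pow] at h1
  push_cast at h1
  nlinarith

end Hardness

/-! ### Numerical estimates -/

section Asymptotics

open Filter

theorem mul_log_sub_add_one_pos {C : ℝ} (hC : 1 < C) : 0 < C * Real.log C - C + 1 := by
  have h0 : 0 < C := by linarith
  have h := Real.log_lt_sub_one_of_pos (inv_pos.2 h0) (by
    intro h
    rw [inv_eq_one] at h
    linarith)
  rw [Real.log_inv] at h
  have h2 := mul_lt_mul_of_pos_left h h0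
  rw [mul_sub, mul_inv_cancel₀ h0.ne'] at h2
  linarith

theorem eventually_log_lt {ε δ : ℝ} (hε : 0 < ε) (hδ : 0 < δ) :
    ∀ᶠ m : ℕ in atTop, Real.log m ≤ δ * (m : ℝ) ^ ε := by
  have h := ((isLittleO_log_rpow_atTop hε).bound hδ).and (eventually_ge_atTop (1 : ℝ))
  filter_upwards [tendsto_natCast_atTop_atTop.eventually h] with m hm
  have h1 := hm.1
  rw [Real.norm_of_nonneg (Real.log_nonneg hm.2),
    Real.norm_of_nonneg (Real.rpow_nonneg (by linarith [hm.2]) _)] at h1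
  exact h1

/-- The numerical condition under which a shattered set of about `2 * m ^ ε` items exists. -/
theorem eventually_shattering_bound {ε C : ℝ} (hε : 0 < ε) (hε' : ε ≤ 1 / 3) (hC : 1 < C) :
    ∀ᶠ m : ℕ in atTop, ∀ N : ℕ, 0 < N → (N : ℝ) ≤ C * (m : ℝ) ^ ((1 : ℝ) / 3 - ε) + 1 →
      ((2 * (⌈(m : ℝ) ^ ε⌉₊ + 1) : ℕ) : ℝ) * N ^ 2 * ((Nat.log 2 (m + 1) + 1 : ℕ) : ℝ) *
          Real.log (m * N + 1) <
        (C * Real.log C - C + 1) * ((m : ℝ) / N) := by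
  set c := C * Real.log C - C + 1 with hc
  have hcpos : 0 < c := mul_log_sub_add_one_pos hC
  -- The factors come from `d ≤ 6 * b`, `N ≤ (C + 1) * a` and the two logarithms, at most `5 * log
  -- m` and `3 * log m`. The choice of `δ` makes `K * δ ^ 2 = c / 2`.
  set K : ℝ := 6 * (C + 1) ^ 3 * 15 with hK
  have hKpos : 0 < K := by positivity
  set δ : ℝ := Real.sqrt (c / (2 * K)) with hδ
  have hδpos : 0 < δ := Real.sqrt_pos.2 (by positivity)
  have hδsq : K * δ ^ 2 < c := by
    rw [hδ, Real.sq_sqrt (by positivity)]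
    have : K * (c / (2 * K)) = c / 2 := by field_simp
    linarith
  filter_upwards [eventually_log_lt hε hδpos, eventually_ge_atTop 3,
    tendsto_natCast_atTop_atTop.eventually (eventually_ge_atTop (C + 2))] with m hlog hm3 hmC
  intro N hN hNle
  have hm : (3 : ℝ) ≤ m := by exact_mod_cast hm3
  have hm0 : (0 : ℝ) < m := by linarith
  have hNr : (0 : ℝ) < N := by exact_mod_cast hN
  set a : ℝ := (m : ℝ) ^ ((1 : ℝ) / 3 - ε) with ha
  set b : ℝ := (m : ℝ) ^ ε with hb
  have ha1 : 1 ≤ a := Real.one_le_rpow (by linarith) (by linarith)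
  have hb1 : 1 ≤ b := Real.one_le_rpow (by linarith) hε.le
  -- This is where the exponent `1/3` enters: `N ^ 3` costs `a ^ 3`, the size `d` costs one factor
  -- `b`, and `log² m` is absorbed by the other two.
  have hab : a ^ 3 * b ^ 3 = m := by
    rw [← mul_pow, ha, hb, ← Real.rpow_add hm0, ← Real.rpow_natCast, ← Real.rpow_mul hm0.le]
    norm_num
  have ham : a ≤ m := by
    have h := Real.rpow_le_rpow_of_exponent_le (show (1 : ℝ) ≤ m by linarith)
      (show (1 : ℝ) / 3 - ε ≤ 1 by linarith)
    rwa [Real.rpow_one] at h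
  have hNa : (N : ℝ) ≤ (C + 1) * a := by nlinarith
  have hNm : (N : ℝ) ≤ (C + 1) * m := hNa.trans (mul_le_mul_of_nonneg_left ham (by linarith))
  have hl1 : 1 ≤ Real.log m := by
    rw [Real.le_log_iff_exp_le hm0]
    linarith [Real.exp_one_lt_d9]
  have hd : ((2 * (⌈b⌉₊ + 1) : ℕ) : ℝ) ≤ 6 * b := by
    have := Nat.ceil_lt_add_one (show (0 : ℝ) ≤ b by linarith)
    push_cast
    linarith
  have hL : ((Nat.log 2 (m + 1) + 1 : ℕ) : ℝ) ≤ 5 * Real.log m := by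
    have h1 : (2 : ℝ) ^ Nat.log 2 (m + 1) ≤ (m : ℝ) ^ 2 := by
      have h : ((2 ^ Nat.log 2 (m + 1) : ℕ) : ℝ) ≤ ((m + 1 : ℕ) : ℝ) :=
        Nat.cast_le.2 (Nat.pow_log_le_self 2 (by omega))
      push_cast at h
      nlinarith
    have h2 := Real.log_le_log (by positivity) h1
    rw [Real.log_pow, Real.log_pow] at h2
    have h3 := Real.log_two_gt_d9
    push_cast at h2 ⊢
    have h4 : (0 : ℝ) ≤ Nat.log 2 (m + 1) := Nat.cast_nonneg _
    nlinarith
  have hlogN : Real.log (m * N + 1) ≤ 3 * Real.log m := by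
    have h1 : (m : ℝ) * N + 1 ≤ (m : ℝ) ^ 3 := by
      have : (m : ℝ) * N ≤ m * ((m - 1) * m) := by
        refine mul_le_mul_of_nonneg_left (hNm.trans ?_) hm0.le
        exact mul_le_mul_of_nonneg_right (by linarith) hm0.le
      nlinarith
    have h2 := Real.log_le_log (by positivity) h1
    rw [Real.log_pow] at h2
    exact_mod_cast h2
  rw [← mul_div_assoc, lt_div_iff₀ hNr]
  have hlogN0 : 0 ≤ Real.log (m * N + 1) := Real.log_nonneg (by nlinarith)
  have hlog2 : Real.log m ^ 2 ≤ (δ * b) ^ 2 := pow_le_pow_left₀ (by linarith) hlog 2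
  calc ((2 * (⌈b⌉₊ + 1) : ℕ) : ℝ) * N ^ 2 * ((Nat.log 2 (m + 1) + 1 : ℕ) : ℝ) *
          Real.log (m * N + 1) * N
      = ((2 * (⌈b⌉₊ + 1) : ℕ) : ℝ) * N ^ 3 * (((Nat.log 2 (m + 1) + 1 : ℕ) : ℝ) *
          Real.log (m * N + 1)) := by ring
    _ ≤ (6 * b) * ((C + 1) * a) ^ 3 * ((5 * Real.log m) * (3 * Real.log m)) := by
        gcongr
    _ = K * a ^ 3 * b * Real.log m ^ 2 := by rw [hK]; ring
    _ ≤ K * a ^ 3 * b * (δ * b) ^ 2 := by gcongr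
    _ = K * δ ^ 2 * (a ^ 3 * b ^ 3) := by ring
    _ = K * δ ^ 2 * m := by rw [hab]
    _ < c * m := mul_lt_mul_of_pos_right hδsq hm0

theorem two_rpow_le_two_pow_ceil (b : ℝ) :
    (2 : ℝ) ^ b ≤ ((2 ^ ⌈b⌉₊ : ℕ) : ℝ) := by
  push_cast
  rw [← Real.rpow_natCast]
  exact Real.rpow_le_rpow_of_exponent_le (by norm_num) (Nat.le_ceil b)

/-- The shift by one accounts for the `+ 1` in the size `2 * (⌈m ^ ε⌉ + 1)` of the shattered set. -/
theorem two_pow_lt_centralBinom_succ (k : ℕ) : 2 ^ k < (k + 1).centralBinom := by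
  induction k with
  | zero => simp [Nat.centralBinom]
  | succ k ih =>
    have h := Nat.succ_mul_centralBinom_succ (k + 1)
    rw [pow_succ]
    by_contra! hle
    nlinarith

end Asymptotics

end CombAuction

/-! ### Proof of the theorem -/

open CombAuction in
theorem mainTheorem8 (ε : ℝ) (hε : 0 < ε) (C : ℝ) (hC : 1 < C) :
    ∃ m₀ : ℕ, ∀ m n : ℕ, m₀ ≤ m → C * (m : ℝ) ^ ((1 : ℝ) / 3 - ε) ≤ (n : ℝ) →
      ∀ D : Set ℝ, (∀ k : ℕ, k ≤ m → (k : ℝ) ∈ D) →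
        ∀ M : CombAuction.Mechanism n m (CombAuction.submodularValuations m D),
          M.IsVCGBased →
          M.HasApproximationRatio ((m : ℝ) ^ ((1 : ℝ) / 3 - ε)) →
          ∃ v : Fin n → CombAuction.submodularValuations m D,
            (2 : ℝ) ^ ((m : ℝ) ^ ε) ≤ (M.bits v : ℝ) := by
  classical
  -- For `ε > 1/3` the ratio is below one, which is impossible: agreement with a constant assignment
  -- would have to exceed `m`.
  rcases lt_or_ge (1 / 3) ε with hlarge | hsmall
  · refine ⟨2, fun m n hm hn D hD M _ hM => ?_⟩
    exfalso
    have hm' : (2 : ℝ) ≤ m := by exact_mod_cast hm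
    have hpos : (0 : ℝ) < (m : ℝ) ^ ((1 : ℝ) / 3 - ε) := Real.rpow_pos_of_pos (by linarith) _
    have hlt : (m : ℝ) ^ ((1 : ℝ) / 3 - ε) < 1 :=
      Real.rpow_lt_one_of_one_lt_of_neg (by linarith) (by linarith)
    have hn0 : 0 < n := by
      have : (0 : ℝ) < n := lt_of_lt_of_le (by positivity) hn
      exact_mod_cast this
    obtain ⟨v, hv⟩ := exists_agreement_of_hasApproximationRatio hD M hM fun _ => ⟨0, hn0⟩
    have hle : ((Finset.card {x | Assigns (M.run v).alloc x ⟨0, hn0⟩} : ℕ) : ℝ) ≤ m := by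
      exact_mod_cast (Finset.card_le_univ _).trans (by simp)
    nlinarith
  · obtain ⟨m₁, hm₁⟩ := Filter.eventually_atTop.1 (eventually_shattering_bound hε hsmall hC)
    refine ⟨max m₁ 1, fun m n hm hn D hD M hVCG hM => ?_⟩
    have hm1 : (1 : ℝ) ≤ m := by exact_mod_cast (le_max_right _ _).trans hm
    set a : ℝ := (m : ℝ) ^ ((1 : ℝ) / 3 - ε) with ha
    have hapos : 0 < a := Real.rpow_pos_of_pos (by linarith) _
    have hCa : 0 < C * a := by positivity
    obtain ⟨H, hH⟩ := hVCG
    -- The least number of bidders for which agreement on `m / a` items is `C` times the random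
    -- average `m / N`; any further bidders are ignored.
    set N : ℕ := ⌈C * a⌉₊ with hN
    have hN0 : 0 < N := Nat.ceil_pos.2 hCa
    have : NeZero N := ⟨hN0.ne'⟩
    have hNn : N ≤ n := Nat.ceil_le.2 hn
    have hNr : (0 : ℝ) < N := by exact_mod_cast hN0
    have hbound := hm₁ m ((le_max_left _ _).trans hm) N hN0 (Nat.ceil_lt_add_one hCa.le).le
    have hagree : ∀ g : Fin m → Fin N, ∃ S ∈ H, ∃ Y : Finset (Fin m),
        C * ((m : ℝ) / N) ≤ Y.card ∧ ∀ x ∈ Y, Assigns S x (Fin.castLE hNn (g x)) := by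
      intro g
      obtain ⟨v, hv⟩ := exists_agreement_of_hasApproximationRatio hD M hM
        fun x => Fin.castLE hNn (g x)
      refine ⟨_, (hH v).1, Finset.univ.filter fun x => Assigns (M.run v).alloc x
        (Fin.castLE hNn (g x)), ?_, fun x hx => (Finset.mem_filter.1 hx).2⟩
      have h1 : C * a ≤ N := Nat.le_ceil _
      rw [← mul_div_assoc, div_le_iff₀ hNr]
      refine (mul_le_mul_of_nonneg_left hv (by linarith : (0 : ℝ) ≤ C)).trans ?_
      rw [← mul_assoc, mul_comm]
      exact mul_le_mul_of_nonneg_left h1 (Nat.cast_nonneg _)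
    obtain ⟨i, j, hij, X, hX, hsh⟩ := exists_pairShatters_of_agreement hNn H hC.le
      (by omega) (Nat.lt_pow_succ_log_self (by norm_num) (m + 1)) hagree hbound
    obtain ⟨v, hv⟩ := exists_bits_gt_of_pairShatters hD M (fun v => (hH v).2) hij
      (Nat.succ_pos _) hX hsh _ (two_pow_lt_centralBinom_succ _)
    exact ⟨v, (two_rpow_le_two_pow_ceil _).trans (Nat.cast_le.2 hv)⟩
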